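/- Let $C\ge 2$ be a real constant. A set function $F:2^V\to\mathbb R$ on a finite set $V$ is submodular if $F(X\cup\{e\})-F(X)\ge F(Y\cup\{e\})-F(Y)$ whenever $X\subseteq Y\subseteq V$ and $e\in V\setminus Y$. A parallel algorithm accesses $F$ through an evaluation oracle, in rounds: in each round it submits a finite collection of subsets of $V$, chosen from the answers of all previous rounds (and, if it is randomized, its random seed), and receives the values of $F$ on all of them; after some round it stops and outputs a subset of $V$. It minimizes $F$ if its output is a minimizer of $F$. **(1)** There is an integer $n_0$, depending only on $C$, such that the following holds. Let $V$ be a finite set with $n$ elements and let $\mathsf{ALG}$ be a (possibly randomized) parallel algorithm that makes at most $n^C$ queries per round on submodular inputs. Then there is a submodular function $F:2^V\to\mathbb R$ such that the probability that $\mathsf{ALG}$ does not minimize $F$ in fewer than $\frac{n}{2C\log_2 n}$ rounds is at least $\frac12$, and is at least $1-\frac1{n^{C-1}}$ if $n\ge n_0$. (For $n \le 1$ the claim is void.) **(2)** Let $V$ be a finite set with $n\ge 1$ elements and let $r\ge C\log_2 n$ be a positive integer such that $2r$ divides $n$. For finite sets $R\subseteq A$ let $f_{A,R}:2^A\to\mathbb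 R$ be $0$ at $R$, $1$ at the strict subsets and the strict supersets of $R$, and $2$ elsewhere. For finite sets $R\subseteq A\subseteq U$ and $S\subseteq U$ write $S_A=S\cap A$, $B=U\setminus A$, $S_B=S\cap B$, and let $\phi_{U,A,R}(S)$ be $|S_B|$ if $S_A\subsetneq R$, $-|S_B|$ if $S_A\supsetneq R$, and $0$ otherwise. Define the family $\mathcal F_r(U)$ of functions on $2^U$ recursively, for $|U|$ a positive multiple of $2r$: if $|U|=2r$, it is $\{f_{U,R}: R\subseteq U, |R|=r\}$; if $|U|>2r$, it consists of the functions $$S\mapsto f_{A,R}(S_A)+\frac1{2|U|}\,\phi_{U,A,R}(S)+\frac1{8|U|}\,\mathbf 1(S_A=R)\,g(S_B)$$ with $R\subseteq A\subseteq U$, $|R|=|A|/2=r$ and $g\in\mathcal F_r(U\setminus A)$. Then every function in $\mathcal F_r(V)$ is submodular, and any (possibly randomized) parallel algorithm that makes at most $n^C$ queries per round on submodular inputs fails, with probability at least $1-\frac1{n^{C-1}}$, to minimize a uniformly random $F\in\mathcal F_r(V)$ in fewer than $\frac n{2r}$ rounds, where the probability is over $F$ and over the random seed, which is independent of $F$.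 -/

import Mathlib

noncomputable section

namespace ParallelSFM

variable {V : Type*}

/-- Submodularity of a set function: the marginal of every element is nonincreasing. -/
def Submodular [DecidableEq V] (F : Finset V → ℝ) : Prop :=
  ∀ X Y : Finset V, X ⊆ Y → ∀ e : V, e ∉ Y →
    F (insert e Y) - F Y ≤ F (insert e X) - F X

/-- `S` is a minimizer of `F` over all subsets of the ground set. -/
def IsMinimizer (F : Finset V → ℝ) (S : Finset V) : Prop :=
  ∀ T : Finset V, F S ≤ F T

/-! ### Parallel algorithms with an evaluation oracle -/

/-- What an algorithm does next: submit one round of (parallel) queries, or stop and output a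
set. -/
inductive Action (V : Type*) where
  | query (B : Finset (Finset V)) : Action V
  | output (S : Finset V) : Action V

/-- The information received so far, in chronological order: for every past round, the set of
pairs (queried set, answer of the oracle). -/
abbrev Transcript (V : Type*) := List (Finset (Finset V × ℝ))

/-- A deterministic parallel algorithm: the next action, as a function of the information
received so far. Computation between the rounds is unrestricted. -/
abbrev Algorithm (V : Type*) := Transcript V → Action V

/-- The answers of the evaluation oracle of `F` to one round of queries. -/
def answers (F : Finset V → ℝ) (B : Finset (Finset V)) : Finset (Finset V × ℝ) :=
  B.map ⟨fun S => (S, F S), fun _ _ h => congrArg Prod.fst h⟩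

/-- The transcript of the run on `F` after (at most) `i` rounds; it stays constant once the
algorithm has stopped. -/
def transcript (alg : Algorithm V) (F : Finset V → ℝ) : ℕ → Transcript V
  | 0 => []
  | i + 1 =>
    match alg (transcript alg F i) with
    | Action.query B => transcript alg F i ++ [answers F B]
    | Action.output _ => transcript alg F i

/-- On every submodular input, each round of queries consists of at most `q` queries. -/
def QueriesPerRoundLE [DecidableEq V] (alg : Algorithm V) (q : ℝ) : Prop :=
  ∀ F : Finset V → ℝ, Submodular F → ∀ (i : ℕ) (B : Finset (Finset V)),
    alg (transcript alg F i) = Action.query B → (B.card : ℝ) ≤ q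

/-- On input `F`, the algorithm stops after at most `k` rounds and outputs a minimizer of `F`. -/
def MinimizesWithin (alg : Algorithm V) (F : Finset V → ℝ) (k : ℕ) : Prop :=
  ∃ S : Finset V, alg (transcript alg F k) = Action.output S ∧ IsMinimizer F S

/-- On input `F`, the algorithm outputs a minimizer of `F` after fewer than `K` rounds
(`K` need not be an integer). -/
def MinimizesInFewerThan (alg : Algorithm V) (F : Finset V → ℝ) (K : ℝ) : Prop :=
  ∃ k : ℕ, (k : ℝ) < K ∧ MinimizesWithin alg F k

/-- A randomized parallel algorithm with random seed in `Ω`: a deterministic algorithm for every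
seed, such that every action in every situation is an event. -/
structure RandomizedAlgorithm (V Ω : Type*) [MeasurableSpace Ω] where
  /-- the deterministic algorithm run on a given seed -/
  run : Ω → Algorithm V
  /-- each decision is a measurable function of the seed -/
  measurable_run : ∀ (h : Transcript V) (a : Action V), MeasurableSet {ω | run ω h = a}

/-! ### The hard family of set functions

A set function on `2 ^ U`, for a finite set `U` of elements of `V`, is represented by the function
`S ↦ F (S ∩ U)` on all finite sets `S`. -/

variable [DecidableEq V]

/-- The function `f_{A,R}` on subsets `S` of `A`. -/
def rankSum (R S : Finset V) : ℝ :=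
  if S = R then 0 else if S ⊂ R ∨ R ⊂ S then 1 else 2

/-- The submodularizer `φ_{U,A,R}`, where `R ⊆ A ⊆ U`. -/
def submodularizer (U A R S : Finset V) : ℝ :=
  if S ∩ A ⊂ R then ((S ∩ (U \ A)).card : ℝ)
  else if R ⊂ S ∩ A then -((S ∩ (U \ A)).card : ℝ)
  else 0

/-- The building block `F^{M,g}_{U,A,R}`, where `R ⊆ A ⊆ U` and `g` is a function on subsets of
`U \ A`. -/
def block (M : ℝ) (U A R : Finset V) (g : Finset V → ℝ) (S : Finset V) : ℝ :=
  rankSum R (S ∩ A) + 1 / (2 * (U.card : ℝ)) * submodularizer U A R S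
    + 1 / (4 * M * (U.card : ℝ)) * (if S ∩ A = R then g (S ∩ (U \ A)) else 0)

open scoped Classical in
/-- The family on a ground set `U` with `2 * r * k` elements, by recursion on the number `k ≥ 1`
of parts. -/
def familyOfParts (r : ℕ) : ℕ → Finset V → Finset (Finset V → ℝ)
  | 0, _ => ∅
  | 1, U => (U.powersetCard r).image fun R S => rankSum R (S ∩ U)
  | k + 2, U =>
    (U.powersetCard (2 * r)).biUnion fun A =>
      (A.powersetCard r).biUnion fun R =>
        (familyOfParts r (k + 1) (U \ A)).image fun g => block 2 U A R g

/-- The family `𝓕_r(V)`, for `r ≥ 1` and `|V|` a positive multiple of `2 * r`. -/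
def family (V : Type*) [Fintype V] [DecidableEq V] (r : ℕ) : Finset (Finset V → ℝ) :=
  familyOfParts r (Fintype.card V / (2 * r)) Finset.univ

end ParallelSFM

end

namespace ParallelSFM

variable {V : Type*} [DecidableEq V]

/-! A block hides its center `R` in `A`, and the inner function `g` affects its values only at sets
`S` with `S ∩ A = R`. A round that queries no such set reveals nothing about `g`. Against `q`
queries a random center in `A` is hit with probability at most `q / a.choose ρ`. If every round
misses, then after `k` rounds the `k` outer blocks may be known, but the center of the last part
must still be guessed among `ρ₀`-subsets. A minimizer has to contain all centers correctly, so the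
success probability is at most `k * (q / a.choose ρ)` plus the reciprocal of the last binomial
coefficient (`card_success_le`). Averaging over the seed (`sum_failure_ge`) covers randomized
algorithms.

Submodularity (`submodular_block`) holds because the submodularizer changes by `1 / (2|U|)` per
element outside `A`, which dominates the variation of the scaled copy of `g`.

The distributional claim takes all parts of size `2r`. The existential claim needs no divisibility,
so `nestedFamily` allows blocks of any size and a larger last part; some member is at least as bad
as the average. -/

/-! ### Local analysis of one block. -/

theorem submodular_of_pairs {F : Finset V → ℝ}
    (h : ∀ (S : Finset V) (e f : V), e ≠ f → e ∉ S → f ∉ S →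
      F (insert e (insert f S)) + F S ≤ F (insert e S) + F (insert f S)) : Submodular F := by
  have key : ∀ (D X : Finset V) (e : V), e ∉ X ∪ D →
      F (insert e (X ∪ D)) - F (X ∪ D) ≤ F (insert e X) - F X := by
    intro D
    induction D using Finset.induction_on with
    | empty => intro X e _; simp
    | insert d D hd ih =>
      intro X e he
      rw [Finset.union_insert] at he ⊢
      have hed : e ≠ d := fun h => he (h ▸ Finset.mem_insert_self _ _)
      have heXD : e ∉ X ∪ D := fun h => he (Finset.mem_insert_of_mem h)
      by_cases hdX : d ∈ X ∪ D
      · rw [Finset.insert_eq_of_mem hdX]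
        exact ih X e heXD
      · have h1 := h (X ∪ D) e d hed heXD hdX
        have h2 := ih X e heXD
        linarith
  intro X Y hXY e he
  have := key Y X e (by rwa [Finset.union_eq_right.2 hXY])
  rwa [Finset.union_eq_right.2 hXY] at this

/-- The value of a block in terms of the position of `X = S ∩ A` relative to `R`. -/
noncomputable def profile (y γ : ℝ) (R X : Finset V) : ℝ :=
  if X ⊆ R then (if R ⊆ X then γ else 1 + y) else if R ⊆ X then 1 - y else 2

theorem rankSum_eq_profile (R X : Finset V) : rankSum R X = profile 0 0 R X := by
  unfold rankSum profile
  by_cases h1 : X ⊆ R <;> by_cases h2 : R ⊆ X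
  · simp [Finset.Subset.antisymm h1 h2]
  · have : X ≠ R := by rintro rfl; exact h2 h1
    simp [Finset.ssubset_iff_subset_ne, this, h1, h2]
  · have : X ≠ R := by rintro rfl; exact h1 h2
    simp [Finset.ssubset_iff_subset_ne, this, h1, h2, this.symm]
  · have : X ≠ R := by rintro rfl; exact h1 subset_rfl
    simp [Finset.ssubset_iff_subset_ne, this, h1, h2]

theorem block_eq_profile (U A R : Finset V) (g : Finset V → ℝ) (S : Finset V) :
    block 2 U A R g S =
      profile (1 / (2 * (U.card : ℝ)) * ((S ∩ (U \ A)).card : ℝ))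
        (1 / (8 * (U.card : ℝ)) * g (S ∩ (U \ A))) R (S ∩ A) := by
  unfold block rankSum submodularizer profile
  have h8 : (4 * 2 * (U.card : ℝ)) = 8 * U.card := by ring
  rw [h8]
  generalize S ∩ A = X
  by_cases h1 : X ⊆ R <;> by_cases h2 : R ⊆ X
  · simp [Finset.Subset.antisymm h1 h2]
  · have : X ≠ R := by rintro rfl; exact h2 h1
    simp [Finset.ssubset_iff_subset_ne, this, h1, h2]
  · have : X ≠ R := by rintro rfl; exact h1 h2
    simp [Finset.ssubset_iff_subset_ne, this, h1, h2, this.symm]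
    ring
  · have : X ≠ R := by rintro rfl; exact h1 subset_rfl
    simp [Finset.ssubset_iff_subset_ne, this, h1, h2]

/-- The tight squares are `X ∪ {e} = R` with `f ∉ R`, where `1 + y` and `1 - y` cancel and `γ ≥ 0`
suffices (also with `e`, `f` exchanged), and `X = R`, which needs `y + γ ≤ 1`. -/
theorem profile_insert_insert {y γ : ℝ} (hy0 : 0 ≤ y) (hy : y ≤ 1 / 2) (hγ0 : 0 ≤ γ)
    (hγ : γ ≤ 1 / 2) (R X : Finset V) {e f : V} (hef : e ≠ f) (he : e ∉ X) (hf : f ∉ X) :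
    profile y γ R (insert e (insert f X)) + profile y γ R X ≤
      profile y γ R (insert e X) + profile y γ R (insert f X) := by
  have hXe : e ∈ R → ¬ R ⊆ X := fun h h' => he (h' h)
  have hXf : f ∈ R → ¬ R ⊆ X := fun h h' => hf (h' h)
  have hfe : e ∈ R → ¬ R ⊆ insert f X := fun h h' =>
    (Finset.mem_insert.1 (h' h)).elim hef he
  have hef' : f ∈ R → ¬ R ⊆ insert e X := fun h h' =>
    (Finset.mem_insert.1 (h' h)).elim hef.symm hf
  have hse : e ∉ R → ∀ Y, (R ⊆ insert e Y ↔ R ⊆ Y) :=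
    fun h Y => Finset.subset_insert_iff_of_notMem h
  have hsf : f ∉ R → ∀ Y, (R ⊆ insert f Y ↔ R ⊆ Y) :=
    fun h Y => Finset.subset_insert_iff_of_notMem h
  unfold profile
  simp only [Finset.insert_subset_iff]
  by_cases he' : e ∈ R <;> by_cases hf' : f ∈ R
  · simp only [he', hf', hXe he', hfe he', hef' hf', true_and, if_false]
    split_ifs <;> linarith
  · rw [Finset.insert_comm]
    simp only [he', hf', hXe he', hfe he', hsf hf', true_and, false_and, if_false]
    split_ifs <;> linarith
  · simp only [he', hf', hXf hf', hef' hf', hse he', true_and, false_and, if_false]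
    split_ifs <;> linarith
  · simp only [he', hf', hse he', hsf hf', false_and, if_false]
    split_ifs <;> linarith

/-- Passing from `(y, γ)` to `(y', γ')` changes the value by `y' - y` below `R`, by `γ' - γ` at `R`,
by `-(y' - y)` above `R` and by `0` elsewhere. This change is antitone in `X` when `γ` varies no
more than `y`. -/
theorem profile_insert_mono {y y' γ γ' : ℝ} (h1 : γ' - γ ≤ y' - y) (h2 : γ - γ' ≤ y' - y)
    (R X : Finset V) (e : V) :
    profile y' γ' R (insert e X) - profile y γ R (insert e X) ≤
      profile y' γ' R X - profile y γ R X := by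
  have hb1 : R ⊆ X → R ⊆ insert e X := fun h => h.trans (Finset.subset_insert _ _)
  have ha : insert e X ⊆ R → X ⊆ R := fun h => (Finset.subset_insert _ _).trans h
  have hab : X ⊆ R → R ⊆ insert e X → ¬ R ⊆ X → insert e X ⊆ R := by
    intro h1 h2 h3
    refine Finset.insert_subset ?_ h1
    by_contra he
    exact h3 ((Finset.subset_insert_iff_of_notMem he).1 h2)
  unfold profile
  by_cases a : X ⊆ R <;> by_cases a' : insert e X ⊆ R <;> by_cases b : R ⊆ X <;>
    by_cases b' : R ⊆ insert e X <;> simp only [a, a', b, b', if_true, if_false] <;>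
    first | linarith | (exfalso; tauto)

/-- The properties of a function on the subsets of `U` that the recursion preserves. -/
structure IsBlockable (U : Finset V) (g : Finset V → ℝ) : Prop where
  nonneg : ∀ S, 0 ≤ g S
  le_two : ∀ S, g S ≤ 2
  inter : ∀ S, g (S ∩ U) = g S

theorem weight_bounds (U A S : Finset V) :
    0 ≤ 1 / (2 * (U.card : ℝ)) * ((S ∩ (U \ A)).card : ℝ) ∧
      1 / (2 * (U.card : ℝ)) * ((S ∩ (U \ A)).card : ℝ) ≤ 1 / 2 := by
  refine ⟨by positivity, ?_⟩
  have h : ((S ∩ (U \ A)).card : ℝ) ≤ U.card := by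
    exact_mod_cast Finset.card_le_card (Finset.inter_subset_right.trans Finset.sdiff_subset)
  rcases Nat.eq_zero_or_pos U.card with h0 | h0
  · simp [h0]
  · have : (0 : ℝ) < U.card := by exact_mod_cast h0
    rw [one_div_mul_eq_div, div_le_iff₀ (by positivity)]
    linarith

theorem scaled_bounds {α : Type*} (U : Finset α) {x : ℝ} (h0 : 0 ≤ x) (h2 : x ≤ 2) :
    0 ≤ 1 / (8 * (U.card : ℝ)) * x ∧ 1 / (8 * (U.card : ℝ)) * x < 1 / 2 := by
  refine ⟨by positivity, ?_⟩
  rcases Nat.eq_zero_or_pos U.card with h | h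
  · simp [h]
  · have : (1 : ℝ) ≤ U.card := by exact_mod_cast h
    rw [one_div_mul_eq_div, div_lt_iff₀ (by positivity)]
    linarith

theorem IsBlockable.block {U A R : Finset V} (hA : A ⊆ U) {g : Finset V → ℝ}
    (hg : IsBlockable (U \ A) g) : IsBlockable U (block 2 U A R g) := by
  have H := fun S => weight_bounds U A S
  have G := fun S => scaled_bounds U (hg.nonneg S) (hg.le_two S)
  refine ⟨fun S => ?_, fun S => ?_, fun S => ?_⟩
  · rw [block_eq_profile]
    have h1 := H S
    have h2 := G (S ∩ (U \ A))
    unfold profile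
    split_ifs <;> linarith
  · rw [block_eq_profile]
    have h1 := H S
    have h2 := G (S ∩ (U \ A))
    unfold profile
    split_ifs <;> linarith
  · have h1 : S ∩ U ∩ A = S ∩ A := by
      rw [Finset.inter_assoc, Finset.inter_eq_right.2 hA]
    have h2 : S ∩ U ∩ (U \ A) = S ∩ (U \ A) := by
      rw [Finset.inter_assoc, Finset.inter_eq_right.2 Finset.sdiff_subset]
    rw [block_eq_profile, block_eq_profile, h1, h2]

theorem isBlockable_rankSum (U R : Finset V) : IsBlockable U fun S => rankSum R (S ∩ U) := by
  refine ⟨fun S => ?_, fun S => ?_, fun S => ?_⟩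
  · unfold rankSum; split_ifs <;> norm_num
  · unfold rankSum; split_ifs <;> norm_num
  · simp

/-! ### Recovering the parameters and the inner function from a block. -/

theorem block_lt_half_iff {U A R : Finset V} {g : Finset V → ℝ}
    (hg : IsBlockable (U \ A) g) (S : Finset V) :
    ParallelSFM.block 2 U A R g S < 1 / 2 ↔ S ∩ A = R := by
  have h1 := weight_bounds U A S
  have h2 := scaled_bounds U (hg.nonneg (S ∩ (U \ A))) (hg.le_two _)
  rw [block_eq_profile]
  unfold profile
  constructor
  · intro h
    split_ifs at h with h3 h4 h4
    · exact Finset.Subset.antisymm h3 h4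
    all_goals linarith
  · rintro rfl
    simpa using h2.2

theorem block_of_inter_eq {U A R : Finset V} {g : Finset V → ℝ}
    (hg : IsBlockable (U \ A) g) {S : Finset V} (h : S ∩ A = R) :
    ParallelSFM.block 2 U A R g S = 1 / (8 * (U.card : ℝ)) * g S := by
  rw [block_eq_profile, hg.inter, ← h]
  simp [profile]

theorem union_inter_sdiff {U A R : Finset V} (hR : R ⊆ A) (T : Finset V) :
    (R ∪ T ∩ (U \ A)) ∩ A = R ∧ (R ∪ T ∩ (U \ A)) ∩ (U \ A) = T ∩ (U \ A) := by
  constructor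
  · ext x
    simp only [Finset.mem_inter, Finset.mem_union, Finset.mem_sdiff]
    have := @hR x
    tauto
  · ext x
    simp only [Finset.mem_inter, Finset.mem_union, Finset.mem_sdiff]
    have := @hR x
    tauto

theorem block_union {U A R : Finset V} (hR : R ⊆ A) {g : Finset V → ℝ}
    (hg : IsBlockable (U \ A) g) (T : Finset V) :
    ParallelSFM.block 2 U A R g (R ∪ T ∩ (U \ A)) = 1 / (8 * (U.card : ℝ)) * g T := by
  have h := union_inter_sdiff (U := U) hR T
  rw [block_of_inter_eq hg h.1, ← hg.inter, h.2, hg.inter]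

theorem IsMinimizer.of_block {U A R : Finset V} (hU : U.Nonempty) (hR : R ⊆ A)
    {g : Finset V → ℝ} (hg : IsBlockable (U \ A) g) {S : Finset V}
    (h : IsMinimizer (ParallelSFM.block 2 U A R g) S) : S ∩ A = R ∧ IsMinimizer g S := by
  have hS : S ∩ A = R := by
    rw [← block_lt_half_iff hg]
    refine (h R).trans_lt ?_
    rw [block_lt_half_iff hg]
    exact Finset.inter_eq_left.2 hR
  refine ⟨hS, fun T => ?_⟩
  have h1 := h (R ∪ T ∩ (U \ A))
  have hc : (0 : ℝ) < U.card := by exact_mod_cast hU.card_pos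
  rw [block_of_inter_eq hg hS, block_union hR hg] at h1
  exact le_of_mul_le_mul_left h1 (by positivity)

theorem block_injective {U A R : Finset V} (hU : U.Nonempty) (hR : R ⊆ A)
    {g g' : Finset V → ℝ} (hg : IsBlockable (U \ A) g) (hg' : IsBlockable (U \ A) g')
    (h : ParallelSFM.block 2 U A R g = ParallelSFM.block 2 U A R g') : g = g' := by
  funext T
  have h1 := congrFun h (R ∪ T ∩ (U \ A))
  have hc : (0 : ℝ) < U.card := by exact_mod_cast hU.card_pos
  rw [block_union hR hg, block_union hR hg'] at h1
  exact mul_left_cancel₀ (by positivity) h1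

/-- The sets of value below `1 / 2` are those with trace `R` on `A`. The smallest is `R` and the
largest inside `U` is `R ∪ (U \ A)`; together they determine `R` and `A`. -/
theorem subset_of_block_eq {U A R A' R' : Finset V} (hA' : A' ⊆ U) (hR : R ⊆ A)
    {g g' : Finset V → ℝ} (hg : IsBlockable (U \ A) g) (hg' : IsBlockable (U \ A') g')
    (h : ParallelSFM.block 2 U A R g = ParallelSFM.block 2 U A' R' g') :
    R' ⊆ R ∧ (R ⊆ R' → A' ⊆ A) := by
  have key : ∀ S, S ∩ A = R → S ∩ A' = R' := fun S hS => by
    rw [← block_lt_half_iff hg', ← h, block_lt_half_iff hg]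
    exact hS
  refine ⟨?_, fun hRR x hx => ?_⟩
  · rw [← key R (Finset.inter_eq_left.2 hR)]
    exact Finset.inter_subset_left
  · by_contra hxA
    have h1 := key (R ∪ U ∩ (U \ A)) (union_inter_sdiff hR U).1
    have h2 : x ∈ R' := by
      rw [← h1]
      simp [hx, hA' hx, hxA]
    have h3 : R' ⊆ R := by
      rw [← key R (Finset.inter_eq_left.2 hR)]
      exact Finset.inter_subset_left
    exact hxA (hR (h3 h2))

theorem eq_of_block_eq {U A R A' R' : Finset V} (hA : A ⊆ U) (hA' : A' ⊆ U) (hR : R ⊆ A)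
    (hR' : R' ⊆ A') {g g' : Finset V → ℝ} (hg : IsBlockable (U \ A) g)
    (hg' : IsBlockable (U \ A') g')
    (h : ParallelSFM.block 2 U A R g = ParallelSFM.block 2 U A' R' g') : A = A' ∧ R = R' := by
  have h1 := subset_of_block_eq hA' hR hg hg' h
  have h2 := subset_of_block_eq hA hR' hg' hg h.symm
  exact ⟨Finset.Subset.antisymm (h2.2 h1.1) (h1.2 h2.1), Finset.Subset.antisymm h2.1 h1.1⟩

/-! ### Submodularity of the blocks. -/

theorem submodular_rankSum_inter (U R : Finset V) :
    Submodular fun S => rankSum R (S ∩ U) := by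
  refine submodular_of_pairs fun S e f hef he hf => ?_
  simp only [rankSum_eq_profile]
  by_cases heU : e ∈ U <;> by_cases hfU : f ∈ U <;>
    simp only [Finset.insert_inter_of_mem, Finset.insert_inter_of_notMem, heU, hfU,
      not_false_eq_true]
  · exact profile_insert_insert le_rfl (by norm_num) le_rfl (by norm_num) R _ hef
      (fun h => he (Finset.mem_inter.1 h).1) (fun h => hf (Finset.mem_inter.1 h).1)
  all_goals linarith

theorem block_insert_of_notMem {U A R : Finset V} (hA : A ⊆ U) (g : Finset V → ℝ)
    (S : Finset V) {e : V} (he : e ∉ U) :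
    ParallelSFM.block 2 U A R g (insert e S) = ParallelSFM.block 2 U A R g S := by
  have h1 : e ∉ A := fun h => he (hA h)
  have h2 : e ∉ U \ A := fun h => he (Finset.sdiff_subset h)
  simp only [block_eq_profile, Finset.insert_inter_of_notMem h1, Finset.insert_inter_of_notMem h2]

theorem block_insert_mixed {U A R : Finset V} {g : Finset V → ℝ}
    (hg : IsBlockable (U \ A) g) (S : Finset V) {e f : V} (hf : f ∉ S)
    (heA : e ∈ A) (hfA : f ∈ U \ A) :
    ParallelSFM.block 2 U A R g (insert e (insert f S)) + ParallelSFM.block 2 U A R g S ≤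
      ParallelSFM.block 2 U A R g (insert e S) + ParallelSFM.block 2 U A R g (insert f S) := by
  have heB : e ∉ U \ A := fun h => (Finset.mem_sdiff.1 h).2 heA
  have hfA' : f ∉ A := (Finset.mem_sdiff.1 hfA).2
  have hc : (0 : ℝ) < U.card := by
    exact_mod_cast Finset.card_pos.2 ⟨f, Finset.sdiff_subset hfA⟩
  simp only [block_eq_profile, Finset.insert_inter_of_mem heA, Finset.insert_inter_of_notMem heB,
    Finset.insert_inter_of_mem hfA, Finset.insert_inter_of_notMem hfA']
  have hfY : f ∉ S ∩ (U \ A) := fun h => hf (Finset.mem_inter.1 h).1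
  have h0 := hg.nonneg (insert f (S ∩ (U \ A)))
  have h0' := hg.nonneg (S ∩ (U \ A))
  have h2 := hg.le_two (insert f (S ∩ (U \ A)))
  have h2' := hg.le_two (S ∩ (U \ A))
  -- The weight grows by four units of `1 / (8|U|)`, while `g`, with values in `[0, 2]`, moves by at
  -- most two.
  have hd : 1 / (2 * (U.card : ℝ)) * ((insert f (S ∩ (U \ A))).card : ℝ)
      - 1 / (2 * (U.card : ℝ)) * ((S ∩ (U \ A)).card : ℝ) = 1 / (8 * (U.card : ℝ)) * 4 := by
    rw [Finset.card_insert_of_notMem hfY]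
    push_cast
    field_simp
    ring
  have hp : (0 : ℝ) ≤ 1 / (8 * (U.card : ℝ)) := by positivity
  have := profile_insert_mono
    (y := 1 / (2 * (U.card : ℝ)) * ((S ∩ (U \ A)).card : ℝ))
    (y' := 1 / (2 * (U.card : ℝ)) * ((insert f (S ∩ (U \ A))).card : ℝ))
    (γ := 1 / (8 * (U.card : ℝ)) * g (S ∩ (U \ A)))
    (γ' := 1 / (8 * (U.card : ℝ)) * g (insert f (S ∩ (U \ A))))
    (by rw [hd, ← mul_sub]; exact mul_le_mul_of_nonneg_left (by linarith) hp)
    (by rw [hd, ← mul_sub]; exact mul_le_mul_of_nonneg_left (by linarith) hp) R (S ∩ A) e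
  linarith

theorem Submodular.pair {g : Finset V → ℝ} (h : Submodular g) (Y : Finset V) {e f : V}
    (hef : e ≠ f) (he : e ∉ Y) :
    g (insert e (insert f Y)) + g Y ≤ g (insert e Y) + g (insert f Y) := by
  have := h Y (insert f Y) (Finset.subset_insert _ _) e (by simp [hef, he])
  linarith

/-- For two elements outside `A` the weight is modular in `S ∩ (U \ A)`, so only the trace `R`
matters, and there `g` is submodular. -/
theorem submodular_block {U A R : Finset V} (hA : A ⊆ U) {g : Finset V → ℝ}
    (hg : IsBlockable (U \ A) g) (hs : Submodular g) :
    Submodular (ParallelSFM.block 2 U A R g) := by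
  refine submodular_of_pairs fun S e f hef he hf => ?_
  by_cases heU : e ∈ U
  swap
  · rw [block_insert_of_notMem hA g _ heU, block_insert_of_notMem hA g _ heU, add_comm]
  by_cases hfU : f ∈ U
  swap
  · rw [Finset.insert_comm, block_insert_of_notMem hA g _ hfU, block_insert_of_notMem hA g _ hfU]
  by_cases heA : e ∈ A <;> by_cases hfA : f ∈ A
  · have heB : e ∉ U \ A := fun h => (Finset.mem_sdiff.1 h).2 heA
    have hfB : f ∉ U \ A := fun h => (Finset.mem_sdiff.1 h).2 hfA
    simp only [block_eq_profile, Finset.insert_inter_of_mem heA, Finset.insert_inter_of_mem hfA,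
      Finset.insert_inter_of_notMem heB, Finset.insert_inter_of_notMem hfB]
    have h1 := weight_bounds U A S
    have h2 := scaled_bounds U (hg.nonneg (S ∩ (U \ A))) (hg.le_two _)
    exact profile_insert_insert h1.1 h1.2 h2.1 h2.2.le R _ hef
      (fun h => he (Finset.mem_inter.1 h).1) (fun h => hf (Finset.mem_inter.1 h).1)
  · exact block_insert_mixed hg S hf heA (Finset.mem_sdiff.2 ⟨hfU, hfA⟩)
  · have := block_insert_mixed (R := R) hg S he hfA (Finset.mem_sdiff.2 ⟨heU, heA⟩)
    rw [Finset.insert_comm, add_comm (ParallelSFM.block 2 U A R g (insert e S))]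
    exact this
  · have heB : e ∈ U \ A := Finset.mem_sdiff.2 ⟨heU, heA⟩
    have hfB : f ∈ U \ A := Finset.mem_sdiff.2 ⟨hfU, hfA⟩
    simp only [block_eq_profile, Finset.insert_inter_of_notMem heA,
      Finset.insert_inter_of_notMem hfA, Finset.insert_inter_of_mem heB,
      Finset.insert_inter_of_mem hfB]
    have heY : e ∉ S ∩ (U \ A) := fun h => he (Finset.mem_inter.1 h).1
    have hfY : f ∉ S ∩ (U \ A) := fun h => hf (Finset.mem_inter.1 h).1
    have heY' : e ∉ insert f (S ∩ (U \ A)) := by simp [hef, heY]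
    rw [Finset.card_insert_of_notMem heY', Finset.card_insert_of_notMem heY,
      Finset.card_insert_of_notMem hfY]
    have h1 := mul_le_mul_of_nonneg_left (hs.pair (S ∩ (U \ A)) hef heY)
      (show (0 : ℝ) ≤ 1 / (8 * (U.card : ℝ)) by positivity)
    unfold profile
    push_cast
    split_ifs <;> linarith

/-! ### The nested family and its cardinality. -/

open scoped Classical in
/-- The recursive family with `k` blocks on ground sets of size `a` with centers of size `ρ`,
and centers of size `ρ₀` in the remaining last part. -/
noncomputable def nestedFamily (a ρ ρ₀ : ℕ) : ℕ → Finset V → Finset (Finset V → ℝ)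
  | 0, U => (U.powersetCard ρ₀).image fun R S => rankSum R (S ∩ U)
  | k + 1, U =>
    (U.powersetCard a).biUnion fun A =>
      (A.powersetCard ρ).biUnion fun R =>
        (nestedFamily a ρ ρ₀ k (U \ A)).image fun g => block 2 U A R g

theorem familyOfParts_eq_nestedFamily (r k : ℕ) (U : Finset V) :
    familyOfParts r (k + 1) U = nestedFamily (2 * r) r r k U := by
  induction k generalizing U with
  | zero => rfl
  | succ k ih =>
    unfold familyOfParts nestedFamily
    simp only [ih]

theorem mem_nestedFamily_zero {a ρ ρ₀ : ℕ} {U : Finset V} {F : Finset V → ℝ} :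
    F ∈ nestedFamily a ρ ρ₀ 0 U ↔
      ∃ R ∈ U.powersetCard ρ₀, (fun S => rankSum R (S ∩ U)) = F := by
  simp [nestedFamily]

theorem mem_nestedFamily_succ {a ρ ρ₀ k : ℕ} {U : Finset V} {F : Finset V → ℝ} :
    F ∈ nestedFamily a ρ ρ₀ (k + 1) U ↔
      ∃ A ∈ U.powersetCard a, ∃ R ∈ A.powersetCard ρ, ∃ g ∈ nestedFamily a ρ ρ₀ k (U \ A),
        block 2 U A R g = F := by
  simp only [nestedFamily, Finset.mem_biUnion, Finset.mem_image]

theorem isBlockable_of_mem_nestedFamily {a ρ ρ₀ k : ℕ} {U : Finset V} {F : Finset V → ℝ}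
    (hF : F ∈ nestedFamily a ρ ρ₀ k U) : IsBlockable U F ∧ Submodular F := by
  induction k generalizing U F with
  | zero =>
    obtain ⟨R, _, rfl⟩ := mem_nestedFamily_zero.1 hF
    exact ⟨isBlockable_rankSum U R, submodular_rankSum_inter U R⟩
  | succ k ih =>
    obtain ⟨A, hA, R, _, g, hg, rfl⟩ := mem_nestedFamily_succ.1 hF
    have hAU := (Finset.mem_powersetCard.1 hA).1
    obtain ⟨h1, h2⟩ := ih hg
    exact ⟨h1.block hAU, submodular_block hAU h1 h2⟩

theorem nestedFamily_nonempty {a ρ ρ₀ : ℕ} (hρ : ρ ≤ a) (k : ℕ) (U : Finset V)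
    (hU : k * a + ρ₀ ≤ U.card) : (nestedFamily a ρ ρ₀ k U).Nonempty := by
  induction k generalizing U with
  | zero =>
    obtain ⟨R, hR⟩ := Finset.powersetCard_nonempty.2 (show ρ₀ ≤ U.card by omega)
    exact ⟨_, mem_nestedFamily_zero.2 ⟨R, hR, rfl⟩⟩
  | succ k ih =>
    rw [Nat.succ_mul] at hU
    obtain ⟨A, hA⟩ := Finset.powersetCard_nonempty.2 (show a ≤ U.card by omega)
    obtain ⟨hAU, hAc⟩ := Finset.mem_powersetCard.1 hA
    obtain ⟨R, hR⟩ := Finset.powersetCard_nonempty.2 (show ρ ≤ A.card by omega)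
    obtain ⟨g, hg⟩ := ih (U \ A) (by rw [Finset.card_sdiff_of_subset hAU]; omega)
    exact ⟨_, mem_nestedFamily_succ.2 ⟨A, hA, R, hR, g, hg, rfl⟩⟩

theorem rankSum_inter_eq_zero_iff (U R S : Finset V) : rankSum R (S ∩ U) = 0 ↔ S ∩ U = R := by
  unfold rankSum
  split_ifs <;> simp_all

theorem rankSum_nonneg (R S : Finset V) : 0 ≤ rankSum R S := by
  unfold rankSum
  split_ifs <;> norm_num

theorem card_nestedFamily_zero (a ρ ρ₀ : ℕ) (U : Finset V) :
    (nestedFamily a ρ ρ₀ 0 U).card = U.card.choose ρ₀ := by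
  rw [← Finset.card_powersetCard]
  classical
  unfold nestedFamily
  refine Finset.card_image_of_injOn fun R hR R' _ h => ?_
  have hRU := (Finset.mem_powersetCard.1 (Finset.mem_coe.1 hR)).1
  have h1 := congrFun h R
  simp only [Finset.inter_eq_left.2 hRU] at h1
  rw [(show rankSum R R = 0 by simp [rankSum])] at h1
  have h2 := (rankSum_inter_eq_zero_iff U R' R).1 (by rw [Finset.inter_eq_left.2 hRU, ← h1])
  rwa [Finset.inter_eq_left.2 hRU] at h2

/-- The function determines `A`, `R` and `g`, so functions are counted as triples; for fixed `A`,
the choices of `R` and `g` are independent. -/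
theorem card_nestedFamily_succ {a : ℕ} (ha : 0 < a) (ρ ρ₀ k : ℕ) (U : Finset V) :
    (nestedFamily a ρ ρ₀ (k + 1) U).card =
      ∑ A ∈ U.powersetCard a, a.choose ρ * (nestedFamily a ρ ρ₀ k (U \ A)).card := by
  classical
  rw [nestedFamily, Finset.card_biUnion]
  · refine Finset.sum_congr rfl fun A hA => ?_
    obtain ⟨hAU, hAc⟩ := Finset.mem_powersetCard.1 hA
    have hU : U.Nonempty := (Finset.card_pos.1 (hAc ▸ ha)).mono hAU
    rw [Finset.card_biUnion]
    · rw [← hAc, ← Finset.card_powersetCard, ← smul_eq_mul, ← Finset.sum_const, hAc]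
      refine Finset.sum_congr rfl fun R hR => Finset.card_image_of_injOn fun g hg g' hg' h => ?_
      exact block_injective hU (Finset.mem_powersetCard.1 hR).1
        (isBlockable_of_mem_nestedFamily hg).1 (isBlockable_of_mem_nestedFamily hg').1 h
    · intro R hR R' hR' hne
      refine Finset.disjoint_left.2 fun F hF hF' => hne ?_
      obtain ⟨g, hg, rfl⟩ := Finset.mem_image.1 hF
      obtain ⟨g', hg', h⟩ := Finset.mem_image.1 hF'
      exact (eq_of_block_eq hAU hAU (Finset.mem_powersetCard.1 hR).1
        (Finset.mem_powersetCard.1 hR').1 (isBlockable_of_mem_nestedFamily hg).1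
        (isBlockable_of_mem_nestedFamily hg').1 h.symm).2
  · intro A hA A' hA' hne
    refine Finset.disjoint_left.2 fun F hF hF' => hne ?_
    obtain ⟨R, hR, hF⟩ := Finset.mem_biUnion.1 hF
    obtain ⟨R', hR', hF'⟩ := Finset.mem_biUnion.1 hF'
    obtain ⟨g, hg, rfl⟩ := Finset.mem_image.1 hF
    obtain ⟨g', hg', h⟩ := Finset.mem_image.1 hF'
    exact (eq_of_block_eq (Finset.mem_powersetCard.1 hA).1 (Finset.mem_powersetCard.1 hA').1
      (Finset.mem_powersetCard.1 hR).1
      (Finset.mem_powersetCard.1 hR').1 (isBlockable_of_mem_nestedFamily hg).1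
      (isBlockable_of_mem_nestedFamily hg').1 h.symm).1

/-! ### Counting the members on which a deterministic algorithm succeeds. -/

open scoped Classical in
theorem card_filter_nestedFamily_succ_le {a ρ ρ₀ k : ℕ} (U : Finset V)
    (p : (Finset V → ℝ) → Prop) :
    ((nestedFamily a ρ ρ₀ (k + 1) U).filter p).card ≤
      ∑ A ∈ U.powersetCard a, ∑ R ∈ A.powersetCard ρ,
        ((nestedFamily a ρ ρ₀ k (U \ A)).filter fun g => p (block 2 U A R g)).card := by
  rw [nestedFamily, Finset.filter_biUnion]
  refine Finset.card_biUnion_le.trans (Finset.sum_le_sum fun A _ => ?_)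
  rw [Finset.filter_biUnion]
  refine Finset.card_biUnion_le.trans (Finset.sum_le_sum fun R _ => ?_)
  rw [Finset.filter_image]
  exact Finset.card_image_le

open scoped Classical in
/-- At most `B.card` centers `R` are hit by a round `B` of queries; if all the other centers
contribute little to an event, then so does the whole family. -/
theorem card_filter_le_of_hits {a ρ ρ₀ k : ℕ} (ha : 0 < a) (hρ : ρ ≤ a) {q ε : ℝ} (hε : 0 ≤ ε)
    (U : Finset V) (p : (Finset V → ℝ) → Prop) (B : Finset (Finset V)) (hB : (B.card : ℝ) ≤ q)
    (h : ∀ A ∈ U.powersetCard a, ∀ R ∈ A.powersetCard ρ, (∀ S ∈ B, S ∩ A ≠ R) →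
      (((nestedFamily a ρ ρ₀ k (U \ A)).filter fun g => p (block 2 U A R g)).card : ℝ) ≤
        ε * (nestedFamily a ρ ρ₀ k (U \ A)).card) :
    (((nestedFamily a ρ ρ₀ (k + 1) U).filter p).card : ℝ) ≤
      (q / a.choose ρ + ε) * (nestedFamily a ρ ρ₀ (k + 1) U).card := by
  have hch : (0 : ℝ) < a.choose ρ := by exact_mod_cast Nat.choose_pos hρ
  refine (Nat.cast_le.2 (card_filter_nestedFamily_succ_le U p)).trans ?_
  rw [card_nestedFamily_succ ha]
  push_cast
  rw [Finset.mul_sum]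
  refine Finset.sum_le_sum fun A hA => ?_
  have hAc := (Finset.mem_powersetCard.1 hA).2
  set N := ((nestedFamily a ρ ρ₀ k (U \ A)).card : ℝ) with hN
  have hN0 : 0 ≤ N := Nat.cast_nonneg _
  have hterm : ∀ R ∈ A.powersetCard ρ,
      (((nestedFamily a ρ ρ₀ k (U \ A)).filter fun g => p (block 2 U A R g)).card : ℝ) ≤
        ε * N + if R ∈ B.image (· ∩ A) then N else 0 := by
    intro R hR
    split_ifs with hmem
    · have : (((nestedFamily a ρ ρ₀ k (U \ A)).filter
          fun g => p (block 2 U A R g)).card : ℝ) ≤ N :=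
        Nat.cast_le.2 (Finset.card_filter_le _ _)
      have := mul_nonneg hε hN0
      linarith
    · rw [add_zero]
      exact h A hA R hR fun S hS hSR => hmem (Finset.mem_image.2 ⟨S, hS, hSR⟩)
  refine (Finset.sum_le_sum hterm).trans ?_
  rw [Finset.sum_add_distrib, Finset.sum_const, Finset.card_powersetCard, hAc, nsmul_eq_mul,
    ← Finset.sum_filter, Finset.sum_const, nsmul_eq_mul]
  have hc : ((((A.powersetCard ρ).filter fun R => R ∈ B.image (· ∩ A)).card : ℕ) : ℝ) ≤ q := by
    refine le_trans (Nat.cast_le.2 ?_) hB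
    refine (Finset.card_le_card fun R hR => (Finset.mem_filter.1 hR).2).trans Finset.card_image_le
  have h1 := mul_le_mul_of_nonneg_right hc hN0
  have h2 : (q / a.choose ρ + ε) * (a.choose ρ * N) = a.choose ρ * (ε * N) + q * N := by
    field_simp
    ring
  rw [h2]
  linarith

theorem transcript_of_output {W : Type*} {alg : Algorithm W} {F : Finset W → ℝ} {i : ℕ} {S : Finset W}
    (h : alg (transcript alg F i) = Action.output S) (j : ℕ) :
    transcript alg F (i + j) = transcript alg F i := by
  induction j with
  | zero => rfl
  | succ j ih => rw [← add_assoc, transcript, ih, h]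

theorem transcript_succ_of_query {W : Type*} {alg : Algorithm W} {F : Finset W → ℝ} {i : ℕ}
    {B : Finset (Finset W)} (h : alg (transcript alg F i) = Action.query B) :
    transcript alg F (i + 1) = transcript alg F i ++ [answers F B] := by
  rw [transcript, h]

theorem answers_congr {W : Type*} {F G : Finset W → ℝ} {B : Finset (Finset W)}
    (h : ∀ S ∈ B, F S = G S) : answers F B = answers G B := by
  refine Finset.coe_injective ?_
  simp only [answers, Finset.coe_map]
  exact Set.image_congr fun S hS => Prod.ext rfl (h S hS)

open scoped Classical in
/-- An algorithm that cannot yet distinguish the members of the family, and that sees them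
through an arbitrary transformation `c` of the values, finds a minimizer after `k` more rounds
only for few members. -/
theorem card_success_le (alg : Algorithm V) {a ρ ρ₀ : ℕ} (ha : 0 < a) (hρ : ρ ≤ a) {q : ℝ}
    (hq : 1 ≤ q) (k : ℕ) (U : Finset V) (c : Finset V → ℝ → ℝ) (i : ℕ) (h : Transcript V)
    (hU : k * a ≤ U.card)
    (hT : ∀ g ∈ nestedFamily a ρ ρ₀ k U, transcript alg (fun S => c S (g S)) i = h)
    (hQ : ∀ g ∈ nestedFamily a ρ ρ₀ k U, ∀ j B,
      alg (transcript alg (fun S => c S (g S)) j) = Action.query B → (B.card : ℝ) ≤ q) :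
    (((nestedFamily a ρ ρ₀ k U).filter fun g => ∃ S,
      alg (transcript alg (fun S => c S (g S)) (i + k)) = Action.output S ∧
        IsMinimizer g S).card : ℝ) ≤
      (k * (q / a.choose ρ) + 1 / (U.card - k * a).choose ρ₀) *
        (nestedFamily a ρ ρ₀ k U).card := by
  induction k generalizing U c i h with
  | zero =>
    rw [card_nestedFamily_zero]
    simp only [Nat.cast_zero, zero_mul, Nat.sub_zero, zero_add, add_zero]
    rcases Nat.eq_zero_or_pos (U.card.choose ρ₀) with h0 | h0
    · have : nestedFamily a ρ ρ₀ 0 U = ∅ := by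
        rw [← Finset.card_eq_zero, card_nestedFamily_zero, h0]
      simp [this, h0]
    · have hpos : (0 : ℝ) < U.card.choose ρ₀ := by exact_mod_cast h0
      rw [one_div_mul_cancel hpos.ne']
      -- The output is the same for all members, and a minimizer `S` reveals the center as `S ∩ U`.
      have : ((nestedFamily a ρ ρ₀ 0 U).filter fun g => ∃ S,
          alg (transcript alg (fun S => c S (g S)) i) = Action.output S ∧
            IsMinimizer g S).card ≤ 1 := by
        refine Finset.card_le_one.2 fun g hg g' hg' => ?_
        obtain ⟨hg, S, hS, hSm⟩ := Finset.mem_filter.1 hg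
        obtain ⟨hg', S', hS', hSm'⟩ := Finset.mem_filter.1 hg'
        rw [hT g hg] at hS
        rw [hT g' hg', hS] at hS'
        obtain rfl : S = S' := by simpa using hS'
        have key : ∀ R ∈ U.powersetCard ρ₀,
            IsMinimizer (fun S => rankSum R (S ∩ U)) S → S ∩ U = R := fun R hR hm => by
          rw [← rankSum_inter_eq_zero_iff]
          refine le_antisymm ((hm R).trans_eq ?_) (rankSum_nonneg _ _)
          exact (rankSum_inter_eq_zero_iff U R R).2
            (Finset.inter_eq_left.2 (Finset.mem_powersetCard.1 hR).1)
        obtain ⟨R, hR, rfl⟩ := mem_nestedFamily_zero.1 hg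
        obtain ⟨R', hR', rfl⟩ := mem_nestedFamily_zero.1 hg'
        rw [← key R hR hSm, ← key R' hR' hSm']
      exact_mod_cast this
  | succ k ih =>
    rw [Nat.succ_mul] at hU ⊢
    have hε : (0 : ℝ) ≤ k * (q / a.choose ρ) + 1 / (U.card - (k * a + a)).choose ρ₀ := by
      positivity
    have hsplit : (((k + 1 : ℕ) : ℝ) * (q / a.choose ρ) +
        1 / (U.card - (k * a + a)).choose ρ₀) = q / a.choose ρ +
          (k * (q / a.choose ρ) + 1 / (U.card - (k * a + a)).choose ρ₀) := by
      push_cast; ring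
    rw [hsplit]
    rcases hact : alg h with B | S₀
    · rcases (nestedFamily a ρ ρ₀ (k + 1) U).eq_empty_or_nonempty with hemp | ⟨g₀, hg₀⟩
      · simp [hemp]
      refine card_filter_le_of_hits ha hρ hε U _ B
        (hQ g₀ hg₀ i B (by rw [hT g₀ hg₀, hact])) fun A hA R hR hmiss => ?_
      obtain ⟨hAU, hAc⟩ := Finset.mem_powersetCard.1 hA
      have hRA := (Finset.mem_powersetCard.1 hR).1
      have hUne : U.Nonempty := (Finset.card_pos.1 (hAc ▸ ha)).mono hAU
      have hcard : (U \ A).card = U.card - a := by rw [Finset.card_sdiff_of_subset hAU, hAc]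
      -- A block's value at `S` depends on `g` only through `g S`, so the outer block is absorbed
      -- into the transformation.
      let c' : Finset V → ℝ → ℝ := fun S x => c S (block 2 U A R (fun _ => x) S)
      have hc' : ∀ g ∈ nestedFamily a ρ ρ₀ k (U \ A),
          (fun S => c S (block 2 U A R g S)) = fun S => c' S (g S) := fun g hg => by
        funext S
        simp only [c', block, (isBlockable_of_mem_nestedFamily hg).1.inter]
      have hmem : ∀ g ∈ nestedFamily a ρ ρ₀ k (U \ A),
          block 2 U A R g ∈ nestedFamily a ρ ρ₀ (k + 1) U := fun g hg =>
        mem_nestedFamily_succ.2 ⟨A, hA, R, hR, g, hg, rfl⟩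
      -- On a round that misses `R` the inner value is multiplied out, so `0` may stand for it.
      have := ih (U \ A) c' (i + 1) (h ++ [answers (fun S => c' S 0) B]) (by omega)
        (fun g hg => by
          have h1 := hT _ (hmem g hg)
          rw [hc' g hg] at h1
          rw [transcript_succ_of_query (by rw [h1, hact]), h1]
          congr 2
          refine answers_congr fun S hS => ?_
          simp only [c', block, if_neg (hmiss S hS)])
        (fun g hg j B' hB' => hQ _ (hmem g hg) j B' (by rw [hc' g hg, hB']))
      rw [hcard, Nat.sub_sub, add_comm a] at this
      refine le_trans (Nat.cast_le.2 (Finset.card_le_card fun g hg => ?_)) this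
      obtain ⟨hg, S, hS, hSm⟩ := Finset.mem_filter.1 hg
      refine Finset.mem_filter.2 ⟨hg, S, ?_,
        (hSm.of_block hUne hRA (isBlockable_of_mem_nestedFamily hg).1).2⟩
      rw [← hS, hc' g hg, add_assoc, add_comm 1 k]
    -- A premature output counts as a single query: unless it hits the center, it minimizes no
    -- member with that center.
    · refine card_filter_le_of_hits ha hρ hε U _ {S₀} (by simpa using hq)
        fun A hA R hR hmiss => ?_
      obtain ⟨hAU, hAc⟩ := Finset.mem_powersetCard.1 hA
      have hRA := (Finset.mem_powersetCard.1 hR).1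
      have hUne : U.Nonempty := (Finset.card_pos.1 (hAc ▸ ha)).mono hAU
      have hempty : ((nestedFamily a ρ ρ₀ k (U \ A)).filter fun g => ∃ S,
          alg (transcript alg (fun S => c S (block 2 U A R g S)) (i + (k + 1))) =
            Action.output S ∧ IsMinimizer (block 2 U A R g) S) = ∅ := by
        refine Finset.filter_eq_empty_iff.2 fun g hg hex => ?_
        obtain ⟨S, hS, hSm⟩ := hex
        have h1 := hT _ (mem_nestedFamily_succ.2 ⟨A, hA, R, hR, g, hg, rfl⟩)
        rw [transcript_of_output (h1 ▸ hact), h1, hact] at hS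
        obtain rfl : S₀ = S := by simpa using hS
        exact hmiss S₀ (Finset.mem_singleton_self _)
          (hSm.of_block hUne hRA (isBlockable_of_mem_nestedFamily hg).1).1
      rw [hempty, Finset.card_empty, Nat.cast_zero]
      positivity

/-! ### Random seeds. -/

open MeasureTheory in
/-- Averaging over the seed: if for every seed only few inputs lie in the complement of the
events, then the events have large probability on average. -/
theorem le_sum_measureReal {Ω ι : Type*} [MeasurableSpace Ω] (μ : Measure Ω)
    [IsProbabilityMeasure μ] (s : Finset ι) (E : ι → Set Ω) {t : ℝ}
    (h : ∀ ω, t ≤ ∑ F ∈ s, (E F).indicator (fun _ => (1 : ℝ)) ω) :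
    t ≤ ∑ F ∈ s, μ.real (E F) := by
  -- The events need not be measurable: a measurable hull has the same measure and a larger
  -- indicator.
  have h1 : ∀ F, μ.real (E F) = ∫ ω, (toMeasurable μ (E F)).indicator (fun _ => (1 : ℝ)) ω ∂μ := by
    intro F
    rw [integral_indicator_const _ (measurableSet_toMeasurable _ _), smul_eq_mul, mul_one]
    simp [Measure.real]
  have hint : ∀ F ∈ s, Integrable ((toMeasurable μ (E F)).indicator fun _ => (1 : ℝ)) μ :=
    fun F _ => (integrable_const 1).indicator (measurableSet_toMeasurable _ _)
  simp only [h1]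
  rw [← integral_finsetSum _ hint]
  have h2 : t = ∫ _, t ∂μ := by simp
  rw [h2]
  refine integral_mono (integrable_const _) (integrable_finsetSum _ hint) fun ω => ?_
  refine (h ω).trans (Finset.sum_le_sum fun F _ => ?_)
  exact Set.indicator_le_indicator_of_subset (subset_toMeasurable _ _) (fun _ => zero_le_one) ω

theorem MinimizesInFewerThan.minimizesWithin {W : Type*} {alg : Algorithm W} {F : Finset W → ℝ}
    {K : ℝ} {k : ℕ} (hK : K ≤ k + 1) (h : MinimizesInFewerThan alg F K) :
    MinimizesWithin alg F k := by
  obtain ⟨j, hj, S, hS, hm⟩ := h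
  have hjk : j ≤ k := by
    have : (j : ℝ) < (k + 1 : ℕ) := by push_cast; linarith
    exact Nat.lt_succ_iff.1 (by exact_mod_cast this)
  obtain ⟨d, rfl⟩ := Nat.exists_eq_add_of_le hjk
  exact ⟨S, by rw [transcript_of_output hS, hS], hm⟩

open MeasureTheory in
open scoped Classical in
theorem sum_failure_ge [Fintype V] {Ω : Type*} [MeasurableSpace Ω] (μ : Measure Ω)
    [IsProbabilityMeasure μ] (alg : RandomizedAlgorithm V Ω) {q : ℝ} (hq : 1 ≤ q)
    (halg : ∀ ω, QueriesPerRoundLE (alg.run ω) q) {a ρ : ℕ} (ρ₀ : ℕ) (ha : 0 < a) (hρ : ρ ≤ a)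
    {k : ℕ} (hk : k * a ≤ Fintype.card V) {K : ℝ} (hK : K ≤ k + 1) :
    (1 - (k * (q / a.choose ρ) + 1 / (Fintype.card V - k * a).choose ρ₀)) *
        (nestedFamily a ρ ρ₀ k (Finset.univ : Finset V)).card ≤
      ∑ F ∈ nestedFamily a ρ ρ₀ k (Finset.univ : Finset V),
        μ.real {ω | ¬ MinimizesInFewerThan (alg.run ω) F K} := by
  refine le_sum_measureReal μ _ _ fun ω => ?_
  have h1 := card_success_le (alg.run ω) (ρ₀ := ρ₀) ha hρ hq k (Finset.univ : Finset V)
    (fun _ x => x) 0 [] (by simpa using hk) (fun _ _ => rfl)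
    (fun g hg j B hB => halg ω g (isBlockable_of_mem_nestedFamily hg).2 j B hB)
  rw [Finset.card_univ, zero_add] at h1
  change (((nestedFamily a ρ ρ₀ k (Finset.univ : Finset V)).filter fun F =>
    MinimizesWithin (alg.run ω) F k).card : ℝ) ≤ _ at h1
  have h2 : ∀ F ∈ nestedFamily a ρ ρ₀ k (Finset.univ : Finset V),
      1 - (if MinimizesWithin (alg.run ω) F k then (1 : ℝ) else 0) ≤
      {ω | ¬ MinimizesInFewerThan (alg.run ω) F K}.indicator (fun _ => (1 : ℝ)) ω := by
    intro F _
    by_cases hF : MinimizesInFewerThan (alg.run ω) F K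
    · rw [if_pos (hF.minimizesWithin hK)]
      simp [hF]
    · rw [Set.indicator_of_mem (by exact hF)]
      split_ifs <;> norm_num
  refine le_trans ?_ (Finset.sum_le_sum h2)
  rw [Finset.sum_sub_distrib, Finset.sum_const, ← Finset.sum_filter, Finset.sum_const,
    nsmul_eq_mul, nsmul_eq_mul, mul_one, mul_one]
  linarith

/-! ### Central binomial estimates and the choice of parameters. -/

/-- By the ratio of consecutive central binomials, the induction step comes down to `4r(r + 1) ≤ (2r
+ 1)²`. -/
theorem sixteen_pow_le_centralBinom_sq {r : ℕ} (hr : 0 < r) :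
    16 ^ r ≤ r.centralBinom ^ 2 * (4 * r) := by
  induction r, hr using Nat.le_induction with
  | base => norm_num [Nat.centralBinom]
  | succ r hr ih =>
    have h := Nat.succ_mul_centralBinom_succ r
    have h1 : (2 * (2 * r + 1)) ^ 2 * 16 ^ (r + 1) ≤
        (2 * (2 * r + 1)) ^ 2 * ((r + 1).centralBinom ^ 2 * (4 * (r + 1))) := by
      calc (2 * (2 * r + 1)) ^ 2 * 16 ^ (r + 1)
          = (2 * (2 * r + 1)) ^ 2 * 16 * 16 ^ r := by ring
        _ ≤ (2 * (2 * r + 1)) ^ 2 * 16 * (r.centralBinom ^ 2 * (4 * r)) :=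
            Nat.mul_le_mul_left _ ih
        _ = (2 * (2 * r + 1) * r.centralBinom) ^ 2 * (64 * r) := by ring
        _ = ((r + 1) * (r + 1).centralBinom) ^ 2 * (64 * r) := by rw [← h]
        _ = ((r + 1).centralBinom ^ 2 * (16 * (r + 1))) * (4 * r * (r + 1)) := by ring
        _ ≤ ((r + 1).centralBinom ^ 2 * (16 * (r + 1))) * (2 * r + 1) ^ 2 :=
            Nat.mul_le_mul_left _ (by nlinarith)
        _ = _ := by ring
    exact Nat.le_of_mul_le_mul_left h1 (by positivity)

theorem four_pow_le_choose_half_sq (m : ℕ) : 4 ^ m ≤ m.choose (m / 2) ^ 2 * (2 * (m + 1)) := by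
  rcases Nat.even_or_odd' m with ⟨r, rfl | rfl⟩
  · rcases Nat.eq_zero_or_pos r with rfl | hr
    · norm_num
    · have h := sixteen_pow_le_centralBinom_sq hr
      rw [Nat.mul_div_cancel_left _ (by norm_num : 0 < 2), ← Nat.centralBinom_eq_two_mul_choose,
        pow_mul]
      refine h.trans (Nat.mul_le_mul_left _ (by omega))
  · have h := sixteen_pow_le_centralBinom_sq (Nat.succ_pos r)
    have h1 : (2 * r + 1) / 2 = r := by omega
    have h2 : (r + 1).centralBinom = 2 * (2 * r + 1).choose r := by
      rw [Nat.centralBinom_eq_two_mul_choose, show 2 * (r + 1) = 2 * r + 1 + 1 by ring,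
        Nat.choose_succ_succ, ← Nat.choose_symm_half]
      ring
    rw [h1]
    rw [h2] at h
    have h3 : 4 * 4 ^ (2 * r + 1) = 16 ^ (r + 1) := by
      rw [← pow_succ', show 2 * r + 1 + 1 = 2 * (r + 1) by ring, pow_mul]
      norm_num
    rw [Nat.succ_eq_add_one] at h
    rw [← h3] at h
    nlinarith

theorem two_pow_le_choose_half_sq {m : ℕ} (hm : 3 ≤ m) : 2 ^ m ≤ m.choose (m / 2) ^ 2 := by
  have h1 : 2 * (m + 1) ≤ 2 ^ m := by
    induction m, hm using Nat.le_induction with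
    | base => norm_num
    | succ m hm ih => rw [pow_succ]; omega
  have h2 : 2 ^ m * 2 ^ m ≤ m.choose (m / 2) ^ 2 * 2 ^ m := by
    rw [← mul_pow]
    exact (four_pow_le_choose_half_sq m).trans (Nat.mul_le_mul_left _ h1)
  exact Nat.le_of_mul_le_mul_right h2 (by positivity)

theorem six_le_choose_half {m : ℕ} (hm : 4 ≤ m) : 6 ≤ m.choose (m / 2) :=
  (Nat.choose_le_choose 2 hm).trans (Nat.choose_le_middle 2 m)

theorem two_le_choose_half {m : ℕ} (hm : 2 ≤ m) : 2 ≤ m.choose (m / 2) :=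
  (Nat.choose_one_right m ▸ hm).trans (Nat.choose_le_middle 1 m)

theorem rpow_eq_two_rpow {n : ℝ} (hn : 0 < n) (C : ℝ) : n ^ C = 2 ^ (C * Real.logb 2 n) := by
  rw [mul_comm, Real.rpow_mul (by norm_num), Real.rpow_logb (by norm_num) (by norm_num) hn]

theorem pow_four_ge_two_pow {n : ℕ} (h2 : 2 ≤ n) (h16 : n ≤ 16) : 2 ^ n ≤ n ^ 4 := by
  interval_cases n <;> norm_num

/-- If `4 log₂ n < n`, then `16 < n`. -/
theorem sixteen_lt_of_logb_lt {n : ℕ} (h2 : 2 ≤ n) (h : 4 * Real.logb 2 n < n) : 16 < n := by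
  by_contra! h16
  have h1 : ((2 : ℝ) ^ n) ≤ (n : ℝ) ^ 4 := by exact_mod_cast pow_four_ge_two_pow h2 h16
  have hn : (0 : ℝ) < n := by exact_mod_cast (by omega : 0 < n)
  have h3 := Real.logb_le_logb_of_le (b := 2) (by norm_num) (by positivity) h1
  rw [Real.logb_pow, Real.logb_pow, Real.logb_self_eq_one (by norm_num)] at h3
  push_cast at h3
  linarith

/-- The contribution of the query rounds for blocks of size `⌈2L⌉ - 4`. -/
theorem query_term_le {n k a : ℕ} {L : ℝ} (hL : 4 ≤ L) (hkL : k * (2 * L) < n)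
    (ha : 2 * L - 4 ≤ a) (ha' : (a : ℝ) + 1 ≤ 2 * L) :
    k * ((2 : ℝ) ^ L / a.choose (a / 2)) ≤ 16 * n / (√L * 2 ^ L) := by
  have hch : (0 : ℝ) < a.choose (a / 2) := by exact_mod_cast Nat.choose_pos (Nat.div_le_self a 2)
  have hsL : 0 < √L := Real.sqrt_pos.2 (by linarith)
  have h2L : (0 : ℝ) < 2 ^ L := by positivity
  have h1 : ((4 : ℝ) ^ a) ≤ (a.choose (a / 2) : ℝ) ^ 2 * (2 * (a + 1)) := by
    exact_mod_cast four_pow_le_choose_half_sq a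
  have h2 : (2 : ℝ) ^ a ≤ a.choose (a / 2) * (2 * √L) := by
    refine le_of_sq_le_sq ?_ (by positivity)
    rw [mul_pow, mul_pow, Real.sq_sqrt (by linarith), ← pow_mul, mul_comm a 2, pow_mul]
    norm_num
    refine h1.trans (mul_le_mul_of_nonneg_left ?_ (by positivity))
    linarith
  -- Shortening the blocks by `4` costs the factor `2 ^ 4`.
  have h3 : (2 : ℝ) ^ L * 2 ^ L ≤ 16 * 2 ^ a := by
    rw [← Real.rpow_natCast 2 a, ← Real.rpow_add (by norm_num),
      show (16 : ℝ) = 2 ^ (4 : ℝ) by norm_num, ← Real.rpow_add (by norm_num)]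
    exact Real.rpow_le_rpow_of_exponent_le (by norm_num) (by linarith)
  have h4 : (2 : ℝ) ^ L * 2 ^ L ≤ 32 * √L * a.choose (a / 2) := by nlinarith
  have hk : k * (2 * (√L * √L)) ≤ (n : ℝ) := by
    rw [Real.mul_self_sqrt (by linarith)]; exact hkL.le
  rw [← mul_div_assoc, div_le_div_iff₀ hch (by positivity)]
  have h5 : (k : ℝ) * √L * (2 ^ L * 2 ^ L) ≤ k * √L * (32 * √L * a.choose (a / 2)) :=
    mul_le_mul_of_nonneg_left h4 (by positivity)
  have h6 := mul_le_mul_of_nonneg_right hk (show (0 : ℝ) ≤ 16 * a.choose (a / 2) by positivity)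
  nlinarith

theorem query_term_le_third {n L : ℝ} (hn : 17 ≤ n) (hL : 8 ≤ L) (h : n ^ 2 ≤ 2 ^ L) :
    16 * n / (√L * 2 ^ L) ≤ 1 / 3 := by
  -- Here `48 = 16 * 3`, `17` is the bound on `n`, and `(48 / 17)² < 8`.
  have hs : (48 : ℝ) / 17 ≤ √L := Real.le_sqrt_of_sq_le (by norm_num; linarith)
  rw [div_le_div_iff₀ (by positivity) (by norm_num)]
  have h1 : 48 ≤ √L * n := by
    calc (48 : ℝ) = 48 / 17 * 17 := by norm_num
      _ ≤ √L * n := mul_le_mul hs hn (by norm_num) (Real.sqrt_nonneg L)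
  calc 16 * n * 3 = 48 * n := by ring
    _ ≤ √L * n * n := mul_le_mul_of_nonneg_right h1 (by linarith)
    _ = √L * n ^ 2 := by ring
    _ ≤ √L * 2 ^ L := mul_le_mul_of_nonneg_left h (Real.sqrt_nonneg L)
    _ = 1 * (√L * 2 ^ L) := by ring

theorem query_term_le_half_of_large {n L : ℝ} (hn : 0 ≤ n) (hL : 1024 ≤ L) :
    16 * n / (√L * 2 ^ L) ≤ n / (2 * 2 ^ L) := by
  have hs : 32 ≤ √L := Real.le_sqrt_of_sq_le (by norm_num; linarith)
  rw [div_le_div_iff₀ (by positivity) (by positivity)]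
  calc 16 * n * (2 * 2 ^ L) = 32 * (n * 2 ^ L) := by ring
    _ ≤ √L * (n * 2 ^ L) := mul_le_mul_of_nonneg_right hs (by positivity)
    _ = n * (√L * 2 ^ L) := by ring

theorem two_rpow_le_choose_half {m : ℕ} {L : ℝ} (hm : 3 ≤ m) (h : L * 2 ≤ m) :
    (2 : ℝ) ^ L ≤ m.choose (m / 2) := by
  refine le_of_sq_le_sq ?_ (by positivity)
  have h1 : (2 : ℝ) ^ m ≤ (m.choose (m / 2) : ℝ) ^ 2 := by
    exact_mod_cast two_pow_le_choose_half_sq hm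
  refine le_trans ?_ h1
  rw [← Real.rpow_natCast (2 ^ L) 2, ← Real.rpow_mul (by norm_num), ← Real.rpow_natCast 2 m]
  exact Real.rpow_le_rpow_of_exponent_le (by norm_num) (by simpa using h)

open MeasureTheory in
theorem exists_submodular_failure_ge {V : Type*} [Fintype V] [DecidableEq V] {Ω : Type*}
    [MeasurableSpace Ω] (μ : Measure Ω) [IsProbabilityMeasure μ] (alg : RandomizedAlgorithm V Ω)
    {q : ℝ} (hq : 1 ≤ q) (halg : ∀ ω, QueriesPerRoundLE (alg.run ω) q) {a k : ℕ} (ha : 0 < a)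
    (hk : k * a ≤ Fintype.card V) {K : ℝ} (hK : K ≤ k + 1) :
    ∃ F : Finset V → ℝ, Submodular F ∧
      1 - (k * (q / a.choose (a / 2)) +
          1 / (Fintype.card V - k * a).choose ((Fintype.card V - k * a) / 2)) ≤
        μ.real {ω | ¬ MinimizesInFewerThan (alg.run ω) F K} := by
  have h := sum_failure_ge μ alg hq halg ((Fintype.card V - k * a) / 2) ha (Nat.div_le_self a 2)
    hk hK
  obtain ⟨F, hF, hle⟩ := Finset.exists_le_of_sum_le
    (nestedFamily_nonempty (ρ₀ := (Fintype.card V - k * a) / 2) (Nat.div_le_self a 2) k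
      (Finset.univ : Finset V) (by
      rw [Finset.card_univ]
      have := Nat.div_le_self (Fintype.card V - k * a) 2
      omega))
    (f := fun _ => 1 - (k * (q / a.choose (a / 2)) +
      1 / ((Fintype.card V - k * a).choose ((Fintype.card V - k * a) / 2) : ℝ)))
    (g := fun F => μ.real {ω | ¬ MinimizesInFewerThan (alg.run ω) F K})
    (by rw [Finset.sum_const, nsmul_eq_mul, mul_comm]; exact h)
  exact ⟨F, (isBlockable_of_mem_nestedFamily hF).2, hle⟩

/-- The choice of the number and the size of the blocks, given `n` and `L = C log₂ n`. -/
theorem exists_block_parameters {n : ℕ} {C : ℝ} (hC : 2 ≤ C) (hn : 2 ≤ n) :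
    ∃ a k : ℕ, 0 < a ∧ k * a ≤ n ∧ (n : ℝ) / (2 * C * Real.logb 2 n) ≤ k + 1 ∧
      k * ((n : ℝ) ^ C / a.choose (a / 2)) +
        1 / ((n - k * a).choose ((n - k * a) / 2) : ℝ) ≤ 1 / 2 ∧
      (1024 ≤ C * Real.logb 2 n → 2 * (C * Real.logb 2 n) ^ 2 ≤ n →
        k * ((n : ℝ) ^ C / a.choose (a / 2)) +
          1 / ((n - k * a).choose ((n - k * a) / 2) : ℝ) ≤ 1 / (n : ℝ) ^ (C - 1)) := by
  have hn0 : (0 : ℝ) < n := by exact_mod_cast (by omega : 0 < n)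
  have hn2 : (2 : ℝ) ≤ n := by exact_mod_cast hn
  have hlog : 1 ≤ Real.logb 2 n := by
    rw [Real.le_logb_iff_rpow_le (by norm_num) hn0]; simpa using hn2
  have hnC : (n : ℝ) ^ C = 2 ^ (C * Real.logb 2 n) := rpow_eq_two_rpow hn0 C
  have hnC1 : (n : ℝ) ^ (C - 1) = (n : ℝ) ^ C / n := by
    rw [Real.rpow_sub hn0, Real.rpow_one]
  have hsq : (n : ℝ) ^ 2 ≤ (n : ℝ) ^ C := by
    rw [← Real.rpow_two]
    exact Real.rpow_le_rpow_of_exponent_le (by linarith) hC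
  set L := C * Real.logb 2 n with hLdef
  have hL2 : 2 * Real.logb 2 n ≤ L := mul_le_mul_of_nonneg_right hC (by linarith)
  rw [show 2 * C * Real.logb 2 (n : ℝ) = 2 * L by rw [hLdef]; ring]
  have hLpos : 0 < L := by linarith
  -- If the bound is at most one round, no blocks are needed and only the final guess counts; `2L² ≤
  -- n` is then impossible for large `L`.
  rcases le_or_gt ((n : ℝ) / (2 * L)) 1 with hK | hK
  · refine ⟨1, 0, one_pos, by simp, by simpa using hK, ?_, fun h1 h2 => ?_⟩
    · have h2 : (2 : ℝ) ≤ n.choose (n / 2) := by exact_mod_cast two_le_choose_half hn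
      rw [Nat.zero_mul, Nat.sub_zero, Nat.cast_zero, zero_mul, zero_add]
      exact one_div_le_one_div_of_le (by norm_num) h2
    · rw [div_le_one (by positivity)] at hK
      nlinarith
  · have h2Ln : 2 * L < n := by
      rwa [lt_div_iff₀ (by positivity), one_mul] at hK
    have h16 : 16 < n := sixteen_lt_of_logb_lt hn (by linarith)
    have hn17 : (17 : ℝ) ≤ n := by exact_mod_cast h16
    have hlog4 : 4 ≤ Real.logb 2 n := by
      rw [Real.le_logb_iff_rpow_le (by norm_num) hn0]
      norm_num
      linarith
    have hL8 : 8 ≤ L := by linarith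
    have hceil := Nat.le_ceil (2 * L)
    have hceil' := Nat.ceil_lt_add_one (show 0 ≤ 2 * L by positivity)
    have h16c : 16 ≤ ⌈2 * L⌉₊ := by
      have : (16 : ℝ) ≤ ⌈2 * L⌉₊ := by linarith
      exact_mod_cast this
    -- Since `a + 3 < 2L`, each block saves at least three elements, so the last part has at least
    -- `3k + 1`.
    obtain ⟨a, haeq⟩ : ∃ a, ⌈2 * L⌉₊ = a + 4 := ⟨_, (Nat.sub_add_cancel (by omega)).symm⟩
    have hkceil := Nat.le_ceil ((n : ℝ) / (2 * L))
    have hkceil' := Nat.ceil_lt_add_one (show 0 ≤ (n : ℝ) / (2 * L) by positivity)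
    obtain ⟨k, hkeq⟩ : ∃ k, ⌈(n : ℝ) / (2 * L)⌉₊ = k + 1 :=
      ⟨_, (Nat.sub_add_cancel (Nat.ceil_pos.2 (by positivity))).symm⟩
    rw [haeq] at hceil hceil' h16c
    rw [hkeq] at hkceil hkceil'
    push_cast at hceil hceil' hkceil hkceil'
    have hkK : (k : ℝ) < n / (2 * L) := by linarith
    have hkL : k * (2 * L) < n := by rwa [lt_div_iff₀ (by positivity)] at hkK
    have hk1 : 1 ≤ k := by
      have : (0 : ℝ) < k := by linarith
      exact_mod_cast this
    have hk1' : (1 : ℝ) ≤ k := by exact_mod_cast hk1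
    have hrest : k * a + 3 * k + 1 ≤ n := by
      have h1 : (k : ℝ) * (a + 3) < n :=
        (mul_le_mul_of_nonneg_left (by linarith) (by positivity)).trans_lt hkL
      have h2 : k * (a + 3) < n := by exact_mod_cast h1
      nlinarith
    obtain ⟨m, hm⟩ : ∃ m, n - k * a = m := ⟨_, rfl⟩
    have hm3 : 3 * k + 1 ≤ m := by omega
    have hq := query_term_le (n := n) (k := k) (a := a) (by linarith) hkL (by linarith)
      (by linarith)
    rw [hnC] at hsq
    have h2L : (0 : ℝ) < 2 ^ L := by positivity
    refine ⟨a, k, by omega, by omega, hkceil, ?_, fun h1024 hbig => ?_⟩ <;>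
      rw [hm, hnC]
    -- The failure budget `1 / 2` splits as `1 / 3 + 1 / 6`.
    · have h6 : (6 : ℝ) ≤ m.choose (m / 2) := by exact_mod_cast six_le_choose_half (by omega)
      have h6' := one_div_le_one_div_of_le (by norm_num) h6
      have hthird := query_term_le_third hn17 hL8 hsq
      linarith
    · rw [hnC1, hnC]
      have hhalf := query_term_le_half_of_large (n := (n : ℝ)) hn0.le h1024
      -- Now `k ≥ L - 1`, so the saved elements give the last part size at least `2L`.
      have hKL : L ≤ (n : ℝ) / (2 * L) := by
        rw [le_div_iff₀ (by positivity)]; nlinarith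
      have hm3' : 3 * (k : ℝ) + 1 ≤ m := by exact_mod_cast hm3
      have hm2L : L * 2 ≤ m := by linarith
      have hch := two_rpow_le_choose_half (m := m) (L := L) (by omega) hm2L
      have hlast : 1 / (m.choose (m / 2) : ℝ) ≤ (n : ℝ) / (2 * 2 ^ L) := by
        refine (one_div_le_one_div_of_le h2L hch).trans ?_
        rw [div_le_div_iff₀ (by positivity) (by positivity)]
        nlinarith
      have hsum : (n : ℝ) / (2 * 2 ^ L) + n / (2 * 2 ^ L) = 1 / (2 ^ L / n) := by
        field_simp
        ring
      linarith

theorem eventually_large_logb (C : ℝ) (hC : 0 < C) : ∃ n₀ : ℕ, 2 ≤ n₀ ∧ ∀ n : ℕ, n₀ ≤ n →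
    1024 ≤ C * Real.logb 2 n ∧ 2 * (C * Real.logb 2 n) ^ 2 ≤ n := by
  have h1 : Filter.Tendsto (fun n : ℕ => C * Real.logb 2 n) Filter.atTop Filter.atTop :=
    ((Real.tendsto_logb_atTop (by norm_num)).comp tendsto_natCast_atTop_atTop).const_mul_atTop hC
  have hlog2 : 0 < Real.log 2 := Real.log_pos (by norm_num)
  have h2 := ((Real.isLittleO_pow_log_id_atTop (n := 2)).comp_tendsto
    (tendsto_natCast_atTop_atTop (R := ℝ))).def
      (show 0 < (Real.log 2) ^ 2 / (2 * C ^ 2) by positivity)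
  obtain ⟨n₀, hn₀⟩ := Filter.eventually_atTop.1
    ((h1.eventually_ge_atTop 1024).and (h2.and (Filter.eventually_ge_atTop 2)))
  refine ⟨max n₀ 2, le_max_right _ _, fun n hn => ?_⟩
  obtain ⟨h3, h4, _⟩ := hn₀ n ((le_max_left _ _).trans hn)
  refine ⟨h3, ?_⟩
  simp only [Function.comp, id, Real.norm_eq_abs, abs_pow, sq_abs, Nat.abs_cast] at h4
  rw [Real.logb, mul_pow, div_pow]
  rw [div_mul_eq_mul_div, le_div_iff₀ (by positivity)] at h4
  rw [← mul_assoc, ← mul_div_assoc, div_le_iff₀ (by positivity)]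
  linarith

/-- As `1 ≤ n ^ C`, the final guess costs no more than one round of queries. The total `(k + 1) n ^
C / (2r).choose r` is controlled by `n ^ (2C) ≤ 4 ^ r ≤ 2r * (2r).choose r` and `n = 2r(k + 1)`. -/
theorem central_failure_le {n r k : ℕ} {C : ℝ} (hr : 0 < r) (hn : n = 2 * r * (k + 1))
    (hC : 0 ≤ C) (h : C * Real.logb 2 n ≤ r) :
    k * ((n : ℝ) ^ C / (2 * r).choose r) + 1 / ((n - k * (2 * r)).choose r : ℝ) ≤
      1 / (n : ℝ) ^ (C - 1) := by
  have hn0 : 0 < n := by rw [hn]; positivity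
  have hn0' : (0 : ℝ) < n := by exact_mod_cast hn0
  have hn1 : (1 : ℝ) ≤ n := by exact_mod_cast hn0
  have hr0 : (0 : ℝ) < r := by exact_mod_cast hr
  have hsub : n - k * (2 * r) = 2 * r := by
    rw [hn, mul_add, mul_one, mul_comm k, Nat.add_sub_cancel_left]
  have hcb : (4 : ℝ) ^ r ≤ 2 * r * (2 * r).choose r := by
    rw [← Nat.centralBinom_eq_two_mul_choose]
    exact_mod_cast Nat.four_pow_le_two_mul_self_mul_centralBinom r hr
  have hch : (0 : ℝ) < (2 * r).choose r := by
    exact_mod_cast Nat.choose_pos (by omega)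
  have hq : 1 ≤ (n : ℝ) ^ C := Real.one_le_rpow hn1 hC
  have hq2 : (n : ℝ) ^ C ≤ 2 ^ r := by
    rw [rpow_eq_two_rpow hn0', ← Real.rpow_natCast 2 r]
    exact Real.rpow_le_rpow_of_exponent_le (by norm_num) h
  have hqq : (n : ℝ) ^ C * n ^ C ≤ 4 ^ r := by
    calc (n : ℝ) ^ C * n ^ C ≤ 2 ^ r * 2 ^ r := mul_le_mul hq2 hq2 (by linarith) (by positivity)
      _ = 4 ^ r := by rw [← mul_pow]; norm_num
  have hnk : (n : ℝ) = 2 * r * (k + 1) := by exact_mod_cast hn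
  rw [hsub, Real.rpow_sub hn0', Real.rpow_one, one_div_div]
  calc k * ((n : ℝ) ^ C / (2 * r).choose r) + 1 / ((2 * r).choose r : ℝ)
      ≤ k * ((n : ℝ) ^ C / (2 * r).choose r) + n ^ C / ((2 * r).choose r : ℝ) := by gcongr
    _ = (k + 1) * (n : ℝ) ^ C / (2 * r).choose r := by ring
    _ ≤ n / n ^ C := by
      rw [div_le_div_iff₀ hch (by linarith), mul_assoc]
      calc ((k : ℝ) + 1) * (n ^ C * n ^ C) ≤ (k + 1) * (2 * r * (2 * r).choose r) :=
            mul_le_mul_of_nonneg_left (hqq.trans hcb) (by positivity)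
        _ = n * (2 * r).choose r := by rw [hnk]; ring

end ParallelSFM

open MeasureTheory ParallelSFM in
theorem theorem2 (C : ℝ) (hC : 2 ≤ C) :
    -- the lower bound for every randomized parallel algorithm, on some submodular function: its failure probability is
    -- at least 1/2 for every ground set, and tends to 1 at a rate that depends only on C
    (∃ n₀ : ℕ, ∀ (V : Type*) [Fintype V] [DecidableEq V],
      ∀ (Ω : Type*) [MeasurableSpace Ω] (μ : Measure Ω) [IsProbabilityMeasure μ]
        (alg : RandomizedAlgorithm V Ω),
        (∀ ω, QueriesPerRoundLE (alg.run ω) ((Fintype.card V : ℝ) ^ C)) →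
        ∃ F : Finset V → ℝ, Submodular F ∧
          1 / 2 ≤ μ.real {ω | ¬ MinimizesInFewerThan (alg.run ω) F
            ((Fintype.card V : ℝ) / (2 * C * Real.logb 2 (Fintype.card V)))} ∧
          (n₀ ≤ Fintype.card V →
            1 - 1 / (Fintype.card V : ℝ) ^ (C - 1) ≤
              μ.real {ω | ¬ MinimizesInFewerThan (alg.run ω) F
                ((Fintype.card V : ℝ) / (2 * C * Real.logb 2 (Fintype.card V)))})) ∧
    -- the distributional version, for a uniformly random member of the family
    (∀ (V : Type*) [Fintype V] [DecidableEq V] [Nonempty V] (r : ℕ), 0 < r →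
      C * Real.logb 2 (Fintype.card V) ≤ r → 2 * r ∣ Fintype.card V →
      ∀ (Ω : Type*) [MeasurableSpace Ω] (μ : Measure Ω) [IsProbabilityMeasure μ]
        (alg : RandomizedAlgorithm V Ω),
        (∀ ω, QueriesPerRoundLE (alg.run ω) ((Fintype.card V : ℝ) ^ C)) →
        (∀ F ∈ family V r, Submodular F) ∧
        1 - 1 / (Fintype.card V : ℝ) ^ (C - 1) ≤
          (∑ F ∈ family V r, μ.real {ω | ¬ MinimizesInFewerThan (alg.run ω) F
            ((Fintype.card V : ℝ) / (2 * r))}) / (family V r).card) := by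
  constructor
  · obtain ⟨n₀, hn₀2, hn₀⟩ := eventually_large_logb C (by linarith)
    refine ⟨n₀, fun V _ _ Ω _ μ _ alg halg => ?_⟩
    rcases lt_or_ge (Fintype.card V) 2 with hlt | hge
    · refine ⟨fun _ => 0, fun _ _ _ _ _ => by simp, ?_, fun h => by omega⟩
      -- For `n ≤ 1` the round bound is `0`, by division by zero, and no run takes fewer than `0`
      -- rounds.
      have hK : (Fintype.card V : ℝ) / (2 * C * Real.logb 2 (Fintype.card V)) = 0 := by
        interval_cases Fintype.card V <;> simp
      have huniv : {ω | ¬ MinimizesInFewerThan (alg.run ω) (fun _ => (0 : ℝ)) 0} = Set.univ := by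
        refine Set.eq_univ_of_forall fun ω hω => ?_
        obtain ⟨k, hk, _⟩ := hω
        exact absurd hk (not_lt.2 k.cast_nonneg)
      rw [hK, huniv, probReal_univ]
      norm_num
    · obtain ⟨a, k, ha, hk, hK, hhalf, hlarge⟩ := exists_block_parameters hC hge
      have hq : 1 ≤ (Fintype.card V : ℝ) ^ C :=
        Real.one_le_rpow (by exact_mod_cast (by omega : 1 ≤ Fintype.card V)) (by linarith)
      obtain ⟨F, hF, hfail⟩ := exists_submodular_failure_ge μ alg hq halg ha hk hK
      refine ⟨F, hF, by linarith, fun hn => ?_⟩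
      have := hlarge (hn₀ _ hn).1 (hn₀ _ hn).2
      linarith
  · intro V _ _ _ r hr hlog hdvd Ω _ μ _ alg halg
    obtain ⟨p, hp⟩ := hdvd
    have hV : 0 < Fintype.card V := Fintype.card_pos
    obtain ⟨k, rfl⟩ : ∃ k, p = k + 1 :=
      Nat.exists_eq_succ_of_ne_zero (by rintro rfl; simp [hp] at hV)
    have hfam : family V r = nestedFamily (2 * r) r r k Finset.univ := by
      rw [family, hp, Nat.mul_div_cancel_left _ (by positivity), familyOfParts_eq_nestedFamily]
    rw [hfam]
    refine ⟨fun F hF => (isBlockable_of_mem_nestedFamily hF).2, ?_⟩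
    have hr0 : (0 : ℝ) < r := by exact_mod_cast hr
    have hcard : k * (2 * r) + r ≤ Fintype.card V := by
      rw [hp, mul_add, mul_one, mul_comm k]; omega
    have hq : 1 ≤ (Fintype.card V : ℝ) ^ C :=
      Real.one_le_rpow (by exact_mod_cast hV) (by linarith)
    have hK : (Fintype.card V : ℝ) / (2 * r) ≤ k + 1 := by
      rw [div_le_iff₀ (by positivity), hp]
      push_cast
      linarith
    have h := sum_failure_ge μ alg hq halg r (by positivity : 0 < 2 * r) (by omega : r ≤ 2 * r)
      (by omega : k * (2 * r) ≤ Fintype.card V) hK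
    have hε := central_failure_le hr hp (by linarith) hlog
    have hpos : (0 : ℝ) < (nestedFamily (2 * r) r r k (Finset.univ : Finset V)).card := by
      exact_mod_cast (nestedFamily_nonempty (by omega) k (Finset.univ : Finset V)
        (by rwa [Finset.card_univ])).card_pos
    rw [le_div_iff₀ hpos]
    refine le_trans (mul_le_mul_of_nonneg_right ?_ hpos.le) h
    linarith
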